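/- Let $1 \le \rho$ and let $X \in \mathbb{R}^{m \times \rho}$ have full column rank, with thin singular value decomposition $X = U \Sigma V^T$ ($U \in \mathbb{R}^{m\times\rho}$ with orthonormal columns, $\Sigma \in \mathbb{R}^{\rho\times\rho}$ diagonal with nonnegative entries, $V \in \mathbb{R}^{\rho\times\rho}$ orthogonal). Let $\ell_i(X) = \|U_{(i)}\|^2$ be the leverage scores, where $U_{(i)}$ is the $i$-th row of $U$, and let $q_i = \rho^{-1}\ell_i(X)$ for $i = 1, \dots, m$. For $c \in \mathbb{N}$ let $\mathbf{i}_1, \dots, \mathbf{i}_c$ be i.i.d. random indices in $\{1,\dots,m\}$ with $\mathbb{P}(\mathbf{i}_j = i) = q_i$, and put $S = RW$, where $R \in \mathbb{R}^{m \times c}$ has entries $R_{ij} = 1$ if $\mathbf{i}_j = i$ and $R_{ij} = 0$ otherwise, and $W \in \mathbb{R}^{c\times c}$ is diagonal with $W_{jj} = 1/\sqrt{c\, q_{\mathbf{i}_j}}$ (with $W_{jj} := 0$ on the null event $q_{\mathbf{i}_j} = 0$). Let $\Gamma \in \mathbb{R}^{m \times m}$ be a diagonal matrix with $\Gamma_{ii}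 > 0$ for all $i$, and set $$\hat G = X^T S S^T X, \qquad \hat H = X^T \Gamma S S^T \Gamma X.$$ Then, for every outcome, $\hat H$ is invertible if and only if $\hat G$ is invertible, and $$\mathbb{P}(\hat H \text{ is invertible}) = \mathbb{P}(\hat G \text{ is invertible}) \;\ge\; 1 - 2\rho \exp\left(-\frac{3c}{16\rho}\right).$$ In particular the bound depends neither on $\Gamma$ nor on the number $m$ of rows of $X$. -/

import Mathlib

namespace RowSketch

open Matrix

/-- `X = U Σ Vᵀ` is a thin singular value decomposition of `X ∈ ℝ^{m × ρ}`: `U ∈ ℝ^{m × ρ}` has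
orthonormal columns, `V ∈ ℝ^{ρ × ρ}` is orthogonal and `Σ = diag σ` with `σ ≥ 0`.
(No ordering of the singular values is imposed; in particular the usual non-increasing order
is covered.) -/
structure IsSVD {m ρ : ℕ} (X U : Matrix (Fin m) (Fin ρ) ℝ) (σ : Fin ρ → ℝ)
    (V : Matrix (Fin ρ) (Fin ρ) ℝ) : Prop where
  left_orthonormal : Uᵀ * U = 1
  right_orthogonal : Vᵀ * V = 1
  nonneg : ∀ r, 0 ≤ σ r
  eq_mul : X = U * diagonal σ * Vᵀ

/-- The `i`-th leverage score, `‖U_(i)‖²`, where `U` is the left factor of a thin singular value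
decomposition of `X` and `U_(i)` is its `i`-th row, with the Euclidean norm. -/
noncomputable def leverageScore {m ρ : ℕ} (U : Matrix (Fin m) (Fin ρ) ℝ) (i : Fin m) : ℝ :=
  ‖WithLp.toLp 2 (U i)‖ ^ 2

/-- The selection matrix `R ∈ ℝ^{m × c}` of the drawn row indices `s 0, …, s (c - 1)`. -/
def selectionMatrix {m c : ℕ} (s : Fin c → Fin m) : Matrix (Fin m) (Fin c) ℝ :=
  of fun i j => if s j = i then 1 else 0

/-- The diagonal matrix `W ∈ ℝ^{c × c}` with `W j j = 1 / √(c q_{s j})`. -/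
noncomputable def weightMatrix {m c : ℕ} (q : Fin m → ℝ) (s : Fin c → Fin m) :
    Matrix (Fin c) (Fin c) ℝ :=
  diagonal fun j => 1 / Real.sqrt (c * q (s j))

/-- The sketching matrix `S = R W ∈ ℝ^{m × c}`. -/
noncomputable def sketchMatrix {m c : ℕ} (q : Fin m → ℝ) (s : Fin c → Fin m) :
    Matrix (Fin m) (Fin c) ℝ :=
  selectionMatrix s * weightMatrix q s

/-- The sketched Gram matrix `Ĝ = Xᵀ S Sᵀ X`. -/
noncomputable def sketchedGram {m ρ c : ℕ} (X : Matrix (Fin m) (Fin ρ) ℝ) (q : Fin m → ℝ)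
    (s : Fin c → Fin m) : Matrix (Fin ρ) (Fin ρ) ℝ :=
  Xᵀ * sketchMatrix q s * (sketchMatrix q s)ᵀ * X

/-- The scaled sketch `Ĥ = Xᵀ Γ S Sᵀ Γ X`. -/
noncomputable def scaledSketchedGram {m ρ c : ℕ} (X : Matrix (Fin m) (Fin ρ) ℝ)
    (Γ : Matrix (Fin m) (Fin m) ℝ) (q : Fin m → ℝ) (s : Fin c → Fin m) :
    Matrix (Fin ρ) (Fin ρ) ℝ :=
  Xᵀ * Γ * sketchMatrix q s * (sketchMatrix q s)ᵀ * Γ * X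

/-- Every matrix of full column rank has a thin singular value decomposition. -/
theorem exists_isSVD {m ρ : ℕ} (X : Matrix (Fin m) (Fin ρ) ℝ) (hX : X.rank = ρ) :
    ∃ U σ V, IsSVD X U σ V := by
  have hinj : Function.Injective X.mulVec := by
    have h1 : Module.finrank ℝ (LinearMap.range X.mulVecLin) = ρ := hX
    have h2 := X.mulVecLin.finrank_range_add_finrank_ker
    rw [h1, Module.finrank_fin_fun] at h2
    have h3 : LinearMap.ker X.mulVecLin = ⊥ := Submodule.finrank_eq_zero.mp (by omega)
    exact LinearMap.ker_eq_bot.mp h3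
  have hP : (Xᵀ * X).PosDef := by
    have := Matrix.PosDef.conjTranspose_mul_self X hinj
    simpa [conjTranspose_eq_transpose_of_trivial] using this
  set lam := hP.1.eigenvalues with hlam
  have hpos : ∀ r, 0 < lam r := hP.eigenvalues_pos
  set V : Matrix (Fin ρ) (Fin ρ) ℝ := (hP.1.eigenvectorUnitary : Matrix (Fin ρ) (Fin ρ) ℝ) with hV
  have hV1 : Vᵀ * V = 1 := by
    have := Matrix.mem_unitaryGroup_iff'.mp hP.1.eigenvectorUnitary.2
    simpa [star_eq_conjTranspose, conjTranspose_eq_transpose_of_trivial] using this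
  have hV2 : V * Vᵀ = 1 := mul_eq_one_comm.mp hV1
  have hspec : Xᵀ * X = V * diagonal lam * Vᵀ := by
    have := hP.1.spectral_theorem
    rw [Unitary.conjStarAlgAut_apply] at this
    simpa [star_eq_conjTranspose, conjTranspose_eq_transpose_of_trivial, Function.comp_def]
      using this
  have hs : ∀ r, Real.sqrt (lam r) ≠ 0 := fun r => (Real.sqrt_pos.mpr (hpos r)).ne'
  refine ⟨X * V * diagonal (fun r => (Real.sqrt (lam r))⁻¹), fun r => Real.sqrt (lam r), V,
    ?_, hV1, fun r => Real.sqrt_nonneg _, ?_⟩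
  · calc _ = diagonal (fun r => (Real.sqrt (lam r))⁻¹) * (Vᵀ * (Xᵀ * X) * V)
          * diagonal (fun r => (Real.sqrt (lam r))⁻¹) := by
          simp only [transpose_mul, diagonal_transpose, Matrix.mul_assoc]
      _ = diagonal (fun r => (Real.sqrt (lam r))⁻¹) * ((Vᵀ * V) * diagonal lam * (Vᵀ * V))
          * diagonal (fun r => (Real.sqrt (lam r))⁻¹) := by
          rw [hspec]; simp only [Matrix.mul_assoc]
      _ = 1 := by
          rw [hV1, Matrix.one_mul, Matrix.mul_one, diagonal_mul_diagonal, diagonal_mul_diagonal,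
            ← diagonal_one]
          congr 1; funext r
          have h4 := Real.mul_self_sqrt (hpos r).le
          have h5 := hs r
          field_simp
          nlinarith
  · rw [Matrix.mul_assoc (X * V), diagonal_mul_diagonal]
    have : (fun r => (Real.sqrt (lam r))⁻¹ * Real.sqrt (lam r)) = fun _ => (1 : ℝ) :=
      funext fun r => inv_mul_cancel₀ (hs r)
    rw [this, diagonal_one, Matrix.mul_one, Matrix.mul_assoc, hV2, Matrix.mul_one]

end RowSketch

/-! Each sketched matrix has the form `Aᵀ * A`, so it is invertible iff no nonzero `v` makes `X *ᵥ
v` (resp. `(Γ * X) *ᵥ v`) vanish on all sampled rows. The positive entries of `Γ` only rescale rows,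
so the two conditions agree; both hold once the sampled rows of `U` span the space. The spanning
probability is bounded by a dimension count instead of matrix concentration. Since `Uᵀ * U = 1`, the
rows of `U` form a Parseval frame, and a draw with probability `‖u i‖ ^ 2 / ρ` leaves a subspace `W`
with probability at least `codim W / ρ`. So each draw multiplies the expected codimension by at most
`1 - 1 / ρ` (`sum_codim_sup_span_singleton_le`). Starting from `ρ`, Markov's inequality bounds
failure by `ρ (1 - 1 / ρ) ^ c ≤ ρ exp (-c / ρ)`, which is stronger than required. -/

namespace RowSketch

open Matrix Module MeasureTheory

/-! ### Random spans of Parseval frame vectors. -/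

section ParsevalFrame

variable {ι E : Type*} [Fintype ι] [NormedAddCommGroup E] [InnerProductSpace ℝ E]
  [FiniteDimensional ℝ E]

/-- The squared norms of the vectors of a Parseval frame add up to the dimension. -/
theorem sum_norm_sq_eq_finrank {u : ι → E}
    (hu : ∀ x, ∑ i, inner ℝ (u i) x ^ 2 = ‖x‖ ^ 2) :
    ∑ i, ‖u i‖ ^ 2 = finrank ℝ E := by
  have b := stdOrthonormalBasis ℝ E
  simp_rw [fun i => (b.sum_sq_inner_left (u i)).symm]
  rw [Finset.sum_comm]
  simp [hu]

/-- The vectors of a Parseval frame that lie outside a subspace carry at least the codimension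
of that subspace. -/
theorem finrank_orthogonal_le_sum_norm_sq {u : ι → E}
    (hu : ∀ x, ∑ i, inner ℝ (u i) x ^ 2 = ‖x‖ ^ 2) (W : Submodule ℝ E)
    [DecidablePred (· ∈ W)] :
    (finrank ℝ Wᗮ : ℝ) ≤ ∑ i, if u i ∈ W then 0 else ‖u i‖ ^ 2 := by
  have b := stdOrthonormalBasis ℝ Wᗮ
  have hb : Orthonormal ℝ fun a => (b a : E) := b.orthonormal.comp_linearIsometry Wᗮ.subtypeₗᵢ
  calc (finrank ℝ Wᗮ : ℝ) = ∑ a, ∑ i, inner ℝ (u i) (b a : E) ^ 2 := by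
        simp [hu, hb.1]
    _ = ∑ i, ∑ a, inner ℝ (u i) (b a : E) ^ 2 := Finset.sum_comm
    _ ≤ _ := by
        refine Finset.sum_le_sum fun i _ => ?_
        split_ifs with h
        · refine (Finset.sum_eq_zero fun a _ => ?_).le
          rw [(Submodule.mem_orthogonal W _).1 (b a).2 _ h]
          simp
        -- Bessel's inequality for the orthonormal basis of `Wᗮ`.
        · have := hb.sum_inner_products_le (s := Finset.univ) (u i)
          simpa [real_inner_comm] using this

/-- Drawing one vector of a Parseval frame with probability proportional to its squared norm
shrinks the expected codimension of the generated subspace by a constant factor. -/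
theorem sum_codim_sup_span_singleton_le {u : ι → E}
    (hu : ∀ x, ∑ i, inner ℝ (u i) x ^ 2 = ‖x‖ ^ 2) (hE : 0 < finrank ℝ E)
    (W : Submodule ℝ E) :
    ∑ i, ‖u i‖ ^ 2 / finrank ℝ E *
        ((finrank ℝ E : ℝ) - finrank ℝ ↥(W ⊔ Submodule.span ℝ {u i})) ≤
      ((finrank ℝ E : ℝ) - finrank ℝ W) * (1 - 1 / finrank ℝ E) := by
  classical
  have hd : (0 : ℝ) < finrank ℝ E := by exact_mod_cast hE
  have hW : (finrank ℝ W : ℝ) + finrank ℝ Wᗮ = finrank ℝ E := by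
    exact_mod_cast W.finrank_add_finrank_orthogonal
  have hterm : ∀ i, ‖u i‖ ^ 2 / finrank ℝ E *
        ((finrank ℝ E : ℝ) - finrank ℝ ↥(W ⊔ Submodule.span ℝ {u i})) ≤
      (‖u i‖ ^ 2 * ((finrank ℝ E : ℝ) - finrank ℝ W) -
        if u i ∈ W then 0 else ‖u i‖ ^ 2) / finrank ℝ E := by
    intro i
    rw [div_mul_eq_mul_div]
    refine div_le_div_of_nonneg_right ?_ hd.le
    split_ifs with h
    · rw [sup_eq_left.2 ((Submodule.span_singleton_le_iff_mem _ _).2 h), sub_zero]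
    -- A vector outside `W` lowers the codimension by at least one.
    · have hlt : W < W ⊔ Submodule.span ℝ {u i} := by
        refine left_lt_sup.2 fun hle => h ?_
        exact (Submodule.span_singleton_le_iff_mem _ _).1 hle
      have hr : (finrank ℝ W : ℝ) + 1 ≤ finrank ℝ ↥(W ⊔ Submodule.span ℝ {u i}) := by
        exact_mod_cast Submodule.finrank_lt_finrank_of_lt hlt
      nlinarith [sq_nonneg ‖u i‖]
  refine (Finset.sum_le_sum fun i _ => hterm i).trans ?_
  rw [← Finset.sum_div, Finset.sum_sub_distrib, ← Finset.sum_mul, sum_norm_sq_eq_finrank hu,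
    div_le_iff₀ hd]
  have h1 := finrank_orthogonal_le_sum_norm_sq hu W
  have h2 : ((finrank ℝ E : ℝ) - finrank ℝ W) * (1 - 1 / finrank ℝ E) * finrank ℝ E =
      finrank ℝ E * ((finrank ℝ E : ℝ) - finrank ℝ W) - (finrank ℝ E - finrank ℝ W) := by
    field_simp
  rw [h2]
  linarith

/-- The expected codimension of the span of `W` and `c` independent draws from a Parseval frame
decays geometrically. -/
theorem sum_codim_sup_span_range_le {u : ι → E}
    (hu : ∀ x, ∑ i, inner ℝ (u i) x ^ 2 = ‖x‖ ^ 2) (hE : 0 < finrank ℝ E)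
    (c : ℕ) (W : Submodule ℝ E) :
    ∑ s : Fin c → ι, (∏ j, ‖u (s j)‖ ^ 2 / finrank ℝ E) *
        ((finrank ℝ E : ℝ) - finrank ℝ ↥(W ⊔ Submodule.span ℝ (Set.range fun j => u (s j)))) ≤
      ((finrank ℝ E : ℝ) - finrank ℝ W) * (1 - 1 / finrank ℝ E) ^ c := by
  have hd : (1 : ℝ) ≤ finrank ℝ E := by exact_mod_cast hE
  induction c generalizing W with
  | zero =>
    have h (s : Fin 0 → ι) :
        finrank ℝ ↥(W ⊔ Submodule.span ℝ (Set.range fun j => u (s j))) = finrank ℝ W := by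
      rw [Set.range_eq_empty, Submodule.span_empty, sup_bot_eq]
    simp [h]
  | succ c ih =>
    -- The first draw is absorbed into `W`, which is why the induction runs over all `W`.
    rw [← (Fin.consEquiv fun _ : Fin (c + 1) => ι).sum_comp, Fintype.sum_prod_type]
    have hspan : ∀ (i : ι) (s : Fin c → ι),
        W ⊔ Submodule.span ℝ
            (Set.range fun j => u ((Fin.consEquiv fun _ : Fin (c + 1) => ι) (i, s) j)) =
          (W ⊔ Submodule.span ℝ {u i}) ⊔ Submodule.span ℝ (Set.range fun j => u (s j)) := by
      intro i s
      rw [sup_assoc, ← Submodule.span_union]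
      congr 2
      ext x
      simp [Fin.exists_fin_succ, Fin.consEquiv_apply, eq_comm]
    have hdim (i : ι) (s : Fin c → ι) := congrArg (fun S : Submodule ℝ E => finrank ℝ S) (hspan i s)
    simp only [hdim]
    simp only [Fin.consEquiv_apply, Fin.prod_univ_succ, Fin.cons_zero, Fin.cons_succ,
      mul_assoc, ← Finset.mul_sum]
    calc _ ≤ ∑ i, ‖u i‖ ^ 2 / finrank ℝ E *
          (((finrank ℝ E : ℝ) - finrank ℝ ↥(W ⊔ Submodule.span ℝ {u i})) *
            (1 - 1 / finrank ℝ E) ^ c) :=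
          Finset.sum_le_sum fun i _ => mul_le_mul_of_nonneg_left (ih _) (by positivity)
      _ ≤ ((finrank ℝ E : ℝ) - finrank ℝ W) * (1 - 1 / finrank ℝ E) *
            (1 - 1 / finrank ℝ E) ^ c := by
          simp only [← mul_assoc, ← Finset.sum_mul]
          refine mul_le_mul_of_nonneg_right (sum_codim_sup_span_singleton_le hu hE W)
            (pow_nonneg ?_ _)
          rw [sub_nonneg, div_le_one (by linarith)]
          exact hd
      _ = ((finrank ℝ E : ℝ) - finrank ℝ W) * (1 - 1 / finrank ℝ E) ^ (c + 1) := by ring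

open Classical in
/-- The probability that `c` independent draws from a Parseval frame do not span the space. -/
theorem sum_prod_not_span_le {u : ι → E}
    (hu : ∀ x, ∑ i, inner ℝ (u i) x ^ 2 = ‖x‖ ^ 2) (hE : 0 < finrank ℝ E) (c : ℕ) :
    ∑ s : Fin c → ι with Submodule.span ℝ (Set.range fun j => u (s j)) ≠ ⊤,
        ∏ j, ‖u (s j)‖ ^ 2 / finrank ℝ E ≤
      finrank ℝ E * Real.exp (-(c / finrank ℝ E)) := by
  have hd : (1 : ℝ) ≤ finrank ℝ E := by exact_mod_cast hE
  rw [Finset.sum_filter]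
  -- Markov's inequality: the codimension is an integer, hence at least one when the draws do not
  -- span.
  calc _ ≤ ∑ s : Fin c → ι, (∏ j, ‖u (s j)‖ ^ 2 / finrank ℝ E) *
        ((finrank ℝ E : ℝ) - finrank ℝ ↥(⊥ ⊔ Submodule.span ℝ (Set.range fun j => u (s j)))) := by
        refine Finset.sum_le_sum fun s _ => ?_
        have hp : 0 ≤ ∏ j, ‖u (s j)‖ ^ 2 / (finrank ℝ E : ℝ) :=
          Finset.prod_nonneg fun j _ => by positivity
        rw [bot_sup_eq]
        split_ifs with h
        · have : (finrank ℝ (Submodule.span ℝ (Set.range fun j => u (s j))) : ℝ) + 1 ≤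
              finrank ℝ E := by
            exact_mod_cast Submodule.finrank_lt h
          exact le_mul_of_one_le_right hp (by linarith)
        · refine mul_nonneg hp (sub_nonneg.2 ?_)
          exact_mod_cast Submodule.finrank_le _
    _ ≤ finrank ℝ E * (1 - 1 / finrank ℝ E) ^ c := by
        simpa using sum_codim_sup_span_range_le hu hE c ⊥
    _ ≤ finrank ℝ E * Real.exp (-(1 / finrank ℝ E)) ^ c := by
        gcongr
        · rw [sub_nonneg, div_le_one (by linarith)]
          exact hd
        · exact Real.one_sub_le_exp_neg _
    _ = _ := by
        rw [← Real.exp_nat_mul]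
        congr 2
        ring

end ParsevalFrame

/-! ### Invertibility in terms of the sampled rows. -/

section Invertibility

variable {m ρ c : ℕ}

theorem isUnit_transpose_mul_self_iff (A : Matrix (Fin c) (Fin ρ) ℝ) :
    IsUnit (Aᵀ * A) ↔ ∀ v, A *ᵥ v = 0 → v = 0 := by
  rw [← mulVec_injective_iff_isUnit]
  refine (injective_iff_map_eq_zero (Aᵀ * A).mulVecLin).trans (forall_congr' fun v => ?_)
  have := conjTranspose_mul_self_mulVec_eq_zero A v
  rw [conjTranspose_eq_transpose_of_trivial] at this
  rw [mulVecLin_apply, this]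

theorem transpose_sketchMatrix_mul_mulVec_apply (Y : Matrix (Fin m) (Fin ρ) ℝ) (q : Fin m → ℝ)
    (s : Fin c → Fin m) (v : Fin ρ → ℝ) (j : Fin c) :
    (((sketchMatrix q s)ᵀ * Y) *ᵥ v) j = 1 / √(c * q (s j)) * (Y *ᵥ v) (s j) := by
  rw [sketchMatrix, weightMatrix, transpose_mul, diagonal_transpose, Matrix.mul_assoc,
    ← mulVec_mulVec, mulVec_diagonal, ← mulVec_mulVec]
  congr 1
  simp [selectionMatrix, mulVec, dotProduct]

/-- A sketched Gram matrix is invertible if and only if the sampled rows separate points, provided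
that rows of probability zero vanish. -/
theorem isUnit_sketchedGram_iff (Y : Matrix (Fin m) (Fin ρ) ℝ) {q : Fin m → ℝ}
    (hq : ∀ i, q i ≤ 0 → Y i = 0) (s : Fin c → Fin m) :
    IsUnit (sketchedGram Y q s) ↔ ∀ v, (∀ j, (Y *ᵥ v) (s j) = 0) → v = 0 := by
  have h : sketchedGram Y q s = ((sketchMatrix q s)ᵀ * Y)ᵀ * ((sketchMatrix q s)ᵀ * Y) := by
    simp [sketchedGram, transpose_mul, Matrix.mul_assoc]
  rw [h, isUnit_transpose_mul_self_iff]
  refine forall_congr' fun v => imp_congr_left ?_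
  rw [funext_iff]
  refine forall_congr' fun j => ?_
  rw [transpose_sketchMatrix_mul_mulVec_apply, Pi.zero_apply, mul_eq_zero, or_iff_right_of_imp]
  -- The weight vanishes only through the default values of `√` and division at `q (s j) ≤ 0`, and
  -- then the row itself is zero.
  intro h0
  have hc : (0 : ℝ) < c := by exact_mod_cast j.pos
  have hs : √(c * q (s j)) = 0 := by simpa [or_comm] using h0
  have hqs : q (s j) ≤ 0 := by
    rw [Real.sqrt_eq_zero'] at hs
    exact nonpos_of_mul_nonpos_right hs hc
  simp [mulVec, hq _ hqs]

theorem scaledSketchedGram_eq_sketchedGram (X : Matrix (Fin m) (Fin ρ) ℝ)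
    {Γ : Matrix (Fin m) (Fin m) ℝ} (hΓ : Γ.IsDiag) (q : Fin m → ℝ) (s : Fin c → Fin m) :
    scaledSketchedGram X Γ q s = sketchedGram (Γ * X) q s := by
  rw [scaledSketchedGram, sketchedGram, transpose_mul, hΓ.isSymm.eq, ← Matrix.mul_assoc]

theorem isUnit_scaledSketchedGram_iff {X : Matrix (Fin m) (Fin ρ) ℝ} {q : Fin m → ℝ}
    (hq : ∀ i, q i ≤ 0 → X i = 0) {Γ : Matrix (Fin m) (Fin m) ℝ} (hΓ : Γ.IsDiag)
    (hΓ0 : ∀ i, Γ i i ≠ 0) (s : Fin c → Fin m) :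
    IsUnit (scaledSketchedGram X Γ q s) ↔ IsUnit (sketchedGram X q s) := by
  have hrow : ∀ i, (Γ * X) i = Γ i i • X i := by
    intro i
    ext r
    rw [← hΓ.diagonal_diag]
    simp [diagonal_mul]
  rw [scaledSketchedGram_eq_sketchedGram X hΓ, isUnit_sketchedGram_iff X hq,
    isUnit_sketchedGram_iff _ fun i hi => by rw [hrow, hq i hi, smul_zero]]
  have hmul : ∀ i v, ((Γ * X) *ᵥ v) i = Γ i i * (X *ᵥ v) i := fun i v => by
    rw [mulVec, hrow, smul_dotProduct, smul_eq_mul]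
    rfl
  simp [hmul, hΓ0]

end Invertibility

/-! ### Transfer from `X` to its left singular factor. -/

section SVD

variable {m ρ : ℕ} {X U : Matrix (Fin m) (Fin ρ) ℝ} {σ : Fin ρ → ℝ}
  {V : Matrix (Fin ρ) (Fin ρ) ℝ}

theorem mulVec_injective_of_rank_eq (hX : X.rank = ρ) : Function.Injective X.mulVec := by
  have h1 : finrank ℝ (LinearMap.range X.mulVecLin) = ρ := hX
  have h2 := X.mulVecLin.finrank_range_add_finrank_ker
  rw [h1, finrank_fin_fun] at h2
  have h3 : LinearMap.ker X.mulVecLin = ⊥ := Submodule.finrank_eq_zero.mp (by omega)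
  exact LinearMap.ker_eq_bot.mp h3

/-- Ensures that the rows of probability zero, whose weight is a default value, carry no
information. -/
theorem IsSVD.row_eq_zero (h : IsSVD X U σ V) {i : Fin m} (hi : leverageScore U i ≤ 0) :
    X i = 0 := by
  have hU : U i = 0 := by
    have h0 : ‖WithLp.toLp 2 (U i)‖ = 0 := by
      have : ‖WithLp.toLp 2 (U i)‖ ^ 2 ≤ 0 := hi
      nlinarith [norm_nonneg (WithLp.toLp 2 (U i))]
    simpa using h0
  rw [h.eq_mul, Matrix.mul_assoc]
  ext r
  simp [mul_apply, hU]

/-- The rows of a matrix with orthonormal columns form a Parseval frame. -/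
theorem IsSVD.sum_inner_sq (h : IsSVD X U σ V) (x : EuclideanSpace ℝ (Fin ρ)) :
    ∑ i, inner ℝ (WithLp.toLp 2 (U i) : EuclideanSpace ℝ (Fin ρ)) x ^ 2 = ‖x‖ ^ 2 := by
  have h1 : (U *ᵥ x.ofLp) ⬝ᵥ (U *ᵥ x.ofLp) = x.ofLp ⬝ᵥ x.ofLp := by
    rw [dotProduct_mulVec, ← mulVec_transpose, mulVec_mulVec, h.left_orthonormal, one_mulVec]
  rw [EuclideanSpace.real_norm_sq_eq]
  simpa [dotProduct, mulVec, PiLp.inner_apply, sq, mul_comm] using h1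

/-- With `w = Σ Vᵀ v` one has `X v = U w`, so `w` is orthogonal to a spanning set and vanishes. Then
`X v = 0`, and full column rank gives `v = 0` without inverting `Σ`. -/
theorem IsSVD.eq_zero_of_span_eq_top (h : IsSVD X U σ V) (hX : X.rank = ρ) {κ : Type*}
    (s : κ → Fin m)
    (hs : Submodule.span ℝ
      (Set.range fun j => (WithLp.toLp 2 (U (s j)) : EuclideanSpace ℝ (Fin ρ))) = ⊤)
    {v : Fin ρ → ℝ} (hv : ∀ j, (X *ᵥ v) (s j) = 0) : v = 0 := by
  set w := (diagonal σ * Vᵀ) *ᵥ v with hw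
  have hXv : X *ᵥ v = U *ᵥ w := by
    rw [hw, mulVec_mulVec, ← Matrix.mul_assoc, ← h.eq_mul]
  have hw0 : (WithLp.toLp 2 w : EuclideanSpace ℝ (Fin ρ)) = 0 := by
    rw [← Submodule.mem_bot ℝ, ← Submodule.top_orthogonal_eq_bot, ← hs,
      ← Submodule.span_singleton_le_iff_mem, ← Submodule.isOrtho_iff_le, Submodule.isOrtho_span]
    rintro _ rfl _ ⟨j, rfl⟩
    have := hv j
    rw [hXv] at this
    simpa [mulVec, dotProduct, PiLp.inner_apply] using this
  apply mulVec_injective_of_rank_eq hX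
  have : w = 0 := by simpa using hw0
  rw [hXv, this, mulVec_zero, mulVec_zero]

end SVD

/-! ### From independent draws to finite sums over outcomes. -/

section Probability

variable {ι κ Ω : Type*} [Fintype κ] [MeasurableSpace ι] [MeasurableSingletonClass ι]
  [MeasurableSpace Ω]

/-- The law of a finite family of independent random variables with values in a finite type. -/
theorem measureReal_eq_of_iIndepFun {P : Measure Ω} {X : κ → Ω → ι}
    (hindep : ProbabilityTheory.iIndepFun X P) (s : κ → ι) :
    P.real {ω | (fun j => X j ω) = s} = ∏ j, P.real {ω | X j ω = s j} := by
  have h := hindep.measure_inter_preimage_eq_mul Finset.univ (sets := fun j => {s j})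
    fun j _ => measurableSet_singleton _
  have he : {ω | (fun j => X j ω) = s} = ⋂ j ∈ Finset.univ, X j ⁻¹' {s j} := by
    ext ω
    simp [funext_iff]
  rw [he, measureReal_def, h, ENNReal.toReal_prod]
  rfl

/-- A union bound over the failing outcomes; subadditivity alone suffices, so the event need not be
shown measurable. -/
theorem one_sub_sum_le_measureReal {P : Measure Ω} [IsProbabilityMeasure P] [Fintype (κ → ι)]
    {X : κ → Ω → ι} (hindep : ProbabilityTheory.iIndepFun X P) (p : (κ → ι) → Prop)
    [DecidablePred p] :
    1 - ∑ s : κ → ι with ¬ p s, ∏ j, P.real {ω | X j ω = s j} ≤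
      P.real {ω | p fun j => X j ω} := by
  have h1 : P.real {ω | ¬ p fun j => X j ω} ≤
      ∑ s : κ → ι with ¬ p s, ∏ j, P.real {ω | X j ω = s j} := by
    simp_rw [← measureReal_eq_of_iIndepFun hindep]
    refine le_trans (measureReal_mono ?_ (measure_ne_top _ _)) (measureReal_biUnion_finset_le _ _)
    intro ω hω
    simpa using hω
  have h2 : (1 : ℝ) ≤ P.real {ω | p fun j => X j ω} + P.real {ω | ¬ p fun j => X j ω} := by
    refine le_trans (le_of_eq ?_) (measureReal_union_le _ _)
    rw [← Set.compl_ofPred, Set.union_compl_self, probReal_univ]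
  linarith

end Probability

end RowSketch

theorem mainTheorem4 {m ρ c : ℕ} (hρ : 1 ≤ ρ)
    (X : Matrix (Fin m) (Fin ρ) ℝ) (hX : X.rank = ρ)
    (U : Matrix (Fin m) (Fin ρ) ℝ) (σ : Fin ρ → ℝ) (V : Matrix (Fin ρ) (Fin ρ) ℝ)
    (hSVD : RowSketch.IsSVD X U σ V)
    (q : Fin m → ℝ) (hq : ∀ i, q i = RowSketch.leverageScore U i / ρ)
    {Ω : Type*} [MeasurableSpace Ω] (P : MeasureTheory.Measure Ω)
    [MeasureTheory.IsProbabilityMeasure P]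
    (idx : Fin c → Ω → Fin m) (hmeas : ∀ j, Measurable (idx j))
    (hindep : ProbabilityTheory.iIndepFun idx P)
    (hlaw : ∀ j i, P.real {ω | idx j ω = i} = q i)
    (Γ : Matrix (Fin m) (Fin m) ℝ) (hΓ : Γ.IsDiag) (hΓpos : ∀ i, 0 < Γ i i) :
    (∀ ω, IsUnit (RowSketch.scaledSketchedGram X Γ q (fun j => idx j ω)) ↔
      IsUnit (RowSketch.sketchedGram X q (fun j => idx j ω))) ∧
    P.real {ω | IsUnit (RowSketch.scaledSketchedGram X Γ q (fun j => idx j ω))} =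
      P.real {ω | IsUnit (RowSketch.sketchedGram X q (fun j => idx j ω))} ∧
    P.real {ω | IsUnit (RowSketch.sketchedGram X q (fun j => idx j ω))} ≥
      1 - 2 * (ρ : ℝ) * Real.exp (-(3 * (c : ℝ)) / (16 * (ρ : ℝ))) := by
  classical
  have hρ0 : (0 : ℝ) < ρ := by exact_mod_cast hρ
  have hrow : ∀ i, q i ≤ 0 → X i = 0 := fun i hi =>
    hSVD.row_eq_zero (by rw [hq, div_le_iff₀ hρ0, zero_mul] at hi; exact hi)
  have hiff := RowSketch.isUnit_scaledSketchedGram_iff (c := c) hrow hΓ fun i => (hΓpos i).ne'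
  refine ⟨fun ω => hiff _, by simp only [hiff], ?_⟩
  let u : Fin m → EuclideanSpace ℝ (Fin ρ) := fun i => WithLp.toLp 2 (U i)
  have hfail := RowSketch.sum_prod_not_span_le (u := u) hSVD.sum_inner_sq (by simp; omega) c
  have hspan := RowSketch.one_sub_sum_le_measureReal hindep
    fun s => Submodule.span ℝ (Set.range fun j => u (s j)) = ⊤
  have hmono : P.real {ω | Submodule.span ℝ (Set.range fun j => u (idx j ω)) = ⊤} ≤
      P.real {ω | IsUnit (RowSketch.sketchedGram X q (fun j => idx j ω))} :=
    MeasureTheory.measureReal_mono fun ω hω =>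
      (RowSketch.isUnit_sketchedGram_iff X hrow _).2 fun v hv =>
        hSVD.eq_zero_of_span_eq_top hX _ hω hv
  -- Slack in both constants: `1 ≤ 2` and `3 / 16 ≤ 1`.
  have hexp : (ρ : ℝ) * Real.exp (-(c / ρ)) ≤
      2 * (ρ : ℝ) * Real.exp (-(3 * (c : ℝ)) / (16 * (ρ : ℝ))) := by
    gcongr
    · linarith
    · have h0 : (0 : ℝ) ≤ c / ρ := by positivity
      have : -(3 * (c : ℝ)) / (16 * (ρ : ℝ)) = -(3 / 16 * (c / ρ)) := by
        field_simp
      linarith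
  simp only [hlaw, hq, RowSketch.leverageScore] at hspan
  simp only [finrank_euclideanSpace_fin, u] at hfail
  linarith
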